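/- Let $(X,\rho)$ be a compact metric space and $f\colon X\to X$ a continuous map. For $x\in X$ let $V_f(x)$ be the set of all $f$-invariant Borel probability measures $\mu$ on $X$ for which there is a strictly increasing sequence $(n_k)$ of positive integers with $\frac1{n_k}\sum_{i=0}^{n_k-1}\delta_{f^i(x)}\to\mu$ in the weak$^*$ topology (the measures \emph{generated by} $x$); $x$ is a \emph{generic point} for $\mu$ if $V_f(x)=\{\mu\}$. Write $h_\mu(f)\in[0,\infty]$ for the Kolmogorov–Sinai entropy. Let $\Omega_2=\{0,1\}^{\mathbb Z}$ with the shift $\sigma$, $(\sigma\omega)_i=\omega_{i+1}$, and let $\xi_{1/2}$ be the Bernoulli$(\tfrac12,\tfrac12)$ measure on $\Omega_2$. A set $J\subset\mathbb N$ (where $0\in\mathbb N$) is \emph{completely deterministic} if $h_\mu(\sigma)=0$ for every $\mu\in V_\sigma(\chi_J)$, where $\chi_J\in\Omega_2$ is the characteristic function of $J$ as a subset of $\mathbb Z$; its lower asymptotic density is $\underline d(J)=\liminf_{N\to\infty}\frac1N\operatorname{card}(J\cap[0,N-1])$. **Theorem (Control of the entropy).** Let $\mathbf K=(K_0,K_1)$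 be a pair of disjoint compact subsets of $X$ and let $J\subset\mathbb N$ be completely deterministic with $\underline d(J)>0$. Let $\bar x\in X$, and suppose that some $\omega\in\Omega_2$ which is a $\mathbf K$-itinerary of $\bar x$ over $J$, that is, $f^j(\bar x)\in K_{\omega(j)}$ for every $j\in J$, is a generic point for $\xi_{1/2}$ under $\sigma$. Then every $\mu\in V_f(\bar x)$ satisfies $$h_\mu(f)\ \ge\ \underline d(J)\cdot\log 2\ >\ 0 .$$ -/

import Mathlib

open scoped ENNReal Topology

namespace EntropyControl

noncomputable section

section General

variable {X : Type*} [MeasurableSpace X]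

/-- The empirical measure `(1/n) ∑_{i < n} δ_{f^i(x)}`, for `n ≥ 1`. -/
def empiricalMeasure (f : X → X) (x : X) (n : ℕ+) : MeasureTheory.ProbabilityMeasure X :=
  ⟨((n : ℕ) : ℝ≥0∞)⁻¹ • ∑ i ∈ Finset.range (n : ℕ), MeasureTheory.Measure.dirac (f^[i] x), by
    constructor
    have h : ((n : ℕ) : ℝ≥0∞) ≠ 0 := by exact_mod_cast n.ne_zero
    simp [ENNReal.inv_mul_cancel h (ENNReal.natCast_ne_top _)]⟩

/-- The point `x` generates the `f`-invariant measure `μ`: along some strictly increasing sequence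
of positive integers the empirical measures of `x` converge to `μ` in the weak-* topology. -/
def Generates [TopologicalSpace X] [OpensMeasurableSpace X] (f : X → X) (x : X)
    (μ : MeasureTheory.ProbabilityMeasure X) : Prop :=
  MeasureTheory.MeasurePreserving f (μ : MeasureTheory.Measure X) (μ : MeasureTheory.Measure X) ∧
    ∃ n : ℕ → ℕ+, StrictMono n ∧
      Filter.Tendsto (fun k => empiricalMeasure f x (n k)) Filter.atTop (𝓝 μ)

/-- `V(x)`: the set of all invariant measures generated by `x`. -/
def generatedMeasures [TopologicalSpace X] [OpensMeasurableSpace X] (f : X → X) (x : X) :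
    Set (MeasureTheory.ProbabilityMeasure X) :=
  {μ | Generates f x μ}

/-- `x` is generic for `μ`: `μ` is the unique measure generated by `x`. -/
def IsGeneric [TopologicalSpace X] [OpensMeasurableSpace X] (f : X → X) (x : X)
    (μ : MeasureTheory.ProbabilityMeasure X) : Prop :=
  generatedMeasures f x = {μ}

/-- The `n`-th name of a point with respect to the partition `{ξ = a}`, `a : Fin k`: the level sets
of `partitionName f ξ n` are the atoms of the join of `f^{-i} ξ`, `0 ≤ i < n`. -/
def partitionName (f : X → X) {k : ℕ} (ξ : X → Fin k) (n : ℕ) (x : X) : Fin n → Fin k :=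
  fun i => ξ (f^[(i : ℕ)] x)

/-- The Shannon entropy of the join of `f^{-i} ξ`, `0 ≤ i < n`. -/
def joinEntropy (μ : MeasureTheory.ProbabilityMeasure X) (f : X → X) {k : ℕ} (ξ : X → Fin k)
    (n : ℕ) : ℝ :=
  ∑ w : Fin n → Fin k,
    Real.negMulLog ((μ : MeasureTheory.Measure X).real (partitionName f ξ n ⁻¹' {w}))

/-- The entropy `h_μ(f, ξ) = lim (1/n) H_μ(⋁_{i < n} f^{-i} ξ)` of `f` with respect to a finite
partition. For invariant `μ` the limit exists by subadditivity, so it is the upper limit. -/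
def partitionEntropy (μ : MeasureTheory.ProbabilityMeasure X) (f : X → X) {k : ℕ}
    (ξ : X → Fin k) : ℝ≥0∞ :=
  Filter.limsup (fun n : ℕ => ENNReal.ofReal (joinEntropy μ f ξ n / n)) Filter.atTop

/-- The Kolmogorov-Sinai entropy `h_μ(f)`: the supremum of `h_μ(f, ξ)` over all finite measurable
partitions, a partition being given by a measurable labelling `ξ : X → Fin k`. -/
def entropy (μ : MeasureTheory.ProbabilityMeasure X) (f : X → X) : ℝ≥0∞ :=
  ⨆ (k : ℕ) (ξ : X → Fin k) (_ : Measurable ξ), partitionEntropy μ f ξ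

end General

/-- The lower asymptotic density `liminf (1/N) card (J ∩ [0, N-1])`. -/
def lowerDensity (J : Set ℕ) : ℝ :=
  Filter.liminf (fun N : ℕ => ((J ∩ Set.Iio N).ncard : ℝ) / N) Filter.atTop

/-- The full two-sided shift space `{0,1}^ℤ`, with the product topology and `σ`-algebra. -/
abbrev Omega2 : Type := ℤ → Fin 2

/-- The shift `(σ ω)_i = ω_{i+1}`. -/
def shift (ω : Omega2) : Omega2 := fun i => ω (i + 1)

open Classical in
/-- The characteristic function, in `{0,1}^ℤ`, of a set `J` of natural numbers. -/
def charSeq (J : Set ℕ) : Omega2 := fun i => if ∃ j ∈ J, (j : ℤ) = i then 1 else 0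

/-- `J` is completely deterministic: every measure generated by its characteristic function under
the shift has zero entropy. -/
def CompletelyDeterministic (J : Set ℕ) : Prop :=
  ∀ μ ∈ generatedMeasures shift (charSeq J), entropy μ shift = 0

/-- The Bernoulli measure `ξ_{1/2}` on `{0,1}^ℤ`. -/
def bernoulliHalf : MeasureTheory.ProbabilityMeasure Omega2 :=
  ⟨MeasureTheory.Measure.infinitePi fun _ : ℤ => (PMF.uniformOfFintype (Fin 2)).toMeasure,
    inferInstance⟩

/-- `ω` is a `(K 0, K 1)`-itinerary of `x` over `J`: `f^j(x) ∈ K_{ω(j)}` for all `j ∈ J`. -/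
def IsItinerary {X : Type*} (f : X → X) (K : Fin 2 → Set X) (x : X) (J : Set ℕ) (ω : Omega2) :
    Prop :=
  ∀ j ∈ J, f^[j] x ∈ K (ω (j : ℤ))

end

end EntropyControl

namespace EntropyControl

open MeasureTheory Filter

/-! ### Empirical measures and their weak limits. -/

section EmpiricalMeasures

/-! Follow the triple `(x, charSeq J, ω)` under the product map along the times that generate `μ`.
By compactness a subsequence of its empirical measures converges to a coupling `Λ` of `μ`, a measure
`ν` generated by `charSeq J`, and, by genericity of `ω`, the Bernoulli measure. The itinerary
condition is closed, so it survives in the limit (`measure_eq_one_of_tendsto_empiricalMeasure`):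
almost surely the two-set partition `ξ` separating `K 1` from `K 0` reads the Bernoulli symbol
wherever the `ν`-coordinate is 1.

A Bernoulli word of length `n` has entropy `n log 2`. Given the `ξ`-name and the `ν`-name, only the
symbols at unselected times are free, on average `n (1 - ν{y 0 = 1})` of them. Hence `H(ξ-name) +
H(ν-name) ≥ n ν{y 0 = 1} log 2` (`log_card_le_entropy_add`, `log_two_le_joinEntropy_add`). Divide by
`n`: the `ν`-term vanishes by complete determinism, and `ν{y 0 = 1}` is at least the lower density
(`lowerDensity_le_of_tendsto`). -/

lemma lintegral_empiricalMeasure {X : Type*} [MeasurableSpace X] (f : X → X) (x : X) (n : ℕ+)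
    {g : X → ℝ≥0∞} (hg : Measurable g) :
    ∫⁻ y, g y ∂(empiricalMeasure f x n : Measure X) =
      ((n : ℕ) : ℝ≥0∞)⁻¹ * ∑ i ∈ Finset.range (n : ℕ), g (f^[i] x) := by
  simp [empiricalMeasure, lintegral_finsetSum_measure, lintegral_dirac' _ hg]

lemma empiricalMeasure_apply {X : Type*} [MeasurableSpace X] (f : X → X) (x : X) (n : ℕ+)
    {s : Set X} (hs : MeasurableSet s) :
    (empiricalMeasure f x n : Measure X) s =
      ((n : ℕ) : ℝ≥0∞)⁻¹ * ∑ i ∈ Finset.range (n : ℕ), s.indicator 1 (f^[i] x) := by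
  rw [← lintegral_indicator_one hs, lintegral_empiricalMeasure f x n (measurable_one.indicator hs)]

lemma map_empiricalMeasure {X Y : Type*} [MeasurableSpace X] [MeasurableSpace Y]
    {f : X → X} {g : Y → Y} {π : X → Y} (h : Function.Semiconj π f g) (hπ : Measurable π)
    (x : X) (n : ℕ+) :
    (empiricalMeasure f x n).map hπ.aemeasurable = empiricalMeasure g (π x) n := by
  apply Subtype.ext
  refine Measure.ext fun s hs => ?_
  rw [ProbabilityMeasure.val_eq_to_measure, ProbabilityMeasure.toMeasure_map,
    Measure.map_apply hπ hs, empiricalMeasure_apply _ _ _ (hπ hs),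
    ProbabilityMeasure.val_eq_to_measure, empiricalMeasure_apply _ _ _ hs]
  congr 1
  refine Finset.sum_congr rfl fun i _ => ?_
  rw [← (h.iterate_right i).eq x]
  rfl

lemma integral_empiricalMeasure {X : Type*} [MeasurableSpace X] [TopologicalSpace X]
    [OpensMeasurableSpace X] (f : X → X) (x : X) (n : ℕ+) (g : BoundedContinuousFunction X ℝ) :
    ∫ y, g y ∂(empiricalMeasure f x n : Measure X) =
      ((n : ℕ) : ℝ)⁻¹ * ∑ i ∈ Finset.range (n : ℕ), g (f^[i] x) := by
  simp only [empiricalMeasure, ProbabilityMeasure.coe_mk, integral_smul_measure]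
  rw [integral_finsetSum_measure fun i _ => g.integrable _]
  simp [integral_dirac' _ _ g.continuous.stronglyMeasurable]

/-- Krylov–Bogolyubov: limits of empirical measures are invariant. -/
lemma measurePreserving_of_tendsto_empiricalMeasure {X : Type*} [MeasurableSpace X]
    [TopologicalSpace X] [HasOuterApproxClosed X] [BorelSpace X] {f : X → X} (hf : Continuous f)
    {x : X} {n : ℕ → ℕ+} (hn : StrictMono n) {μ : ProbabilityMeasure X}
    (hμ : Tendsto (fun k => empiricalMeasure f x (n k)) atTop (𝓝 μ)) :
    MeasurePreserving f (μ : Measure X) (μ : Measure X) := by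
  refine ⟨hf.measurable, ?_⟩
  have := Measure.isProbabilityMeasure_map (μ := (μ : Measure X)) hf.measurable.aemeasurable
  refine ext_of_forall_integral_eq_of_IsFiniteMeasure fun g => ?_
  rw [integral_map hf.measurable.aemeasurable g.continuous.aestronglyMeasurable]
  have h := ProbabilityMeasure.tendsto_iff_forall_integral_tendsto.1 hμ
  have h1 := (h (g.compContinuous ⟨f, hf⟩)).sub (h g)
  refine sub_eq_zero.1 (tendsto_nhds_unique h1 ?_)
  simp only [integral_empiricalMeasure]
  -- The two orbit sums telescope to a difference of two end terms, at most `2 * ‖g‖` before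
  -- averaging.
  have hlim : Tendsto (fun k => ((n k : ℕ) : ℝ)⁻¹ * (2 * ‖g‖)) atTop (𝓝 0) := by
    have hn' : StrictMono fun k => (n k : ℕ) := fun a b hab => hn hab
    simpa using ((tendsto_inv_atTop_nhds_zero_nat (𝕜 := ℝ)).comp hn'.tendsto_atTop).mul_const
      (2 * ‖g‖)
  refine squeeze_zero_norm (fun k => ?_) hlim
  rw [← mul_sub, ← Finset.sum_sub_distrib]
  have : ∑ i ∈ Finset.range (n k : ℕ), (g.compContinuous ⟨f, hf⟩ (f^[i] x) - g (f^[i] x)) =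
      g (f^[(n k : ℕ)] x) - g x := by
    refine Eq.trans (Finset.sum_congr rfl fun i _ => ?_)
      (Finset.sum_range_sub (fun i => g (f^[i] x)) (n k))
    simp [Function.iterate_succ_apply']
  rw [this, norm_mul, norm_inv, Real.norm_natCast]
  gcongr
  calc ‖g (f^[(n k : ℕ)] x) - g x‖ ≤ ‖g (f^[(n k : ℕ)] x)‖ + ‖g x‖ := norm_sub_le _ _
    _ ≤ 2 * ‖g‖ := by linarith [g.norm_coe_le_norm (f^[(n k : ℕ)] x), g.norm_coe_le_norm x]

/-- Portmanteau for closed sets; it carries a closed relation along an orbit over to the limit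
measure. -/
lemma measure_eq_one_of_tendsto_empiricalMeasure {X : Type*} [MeasurableSpace X]
    [TopologicalSpace X] [HasOuterApproxClosed X] [OpensMeasurableSpace X] {f : X → X}
    {x : X} {n : ℕ → ℕ+} {μ : ProbabilityMeasure X}
    (hμ : Tendsto (fun k => empiricalMeasure f x (n k)) atTop (𝓝 μ)) {C : Set X} (hC : IsClosed C)
    (hx : ∀ i, f^[i] x ∈ C) : (μ : Measure X) C = 1 := by
  refine le_antisymm prob_le_one ?_
  refine le_trans ?_ (ProbabilityMeasure.limsup_measure_closed_le_of_tendsto hμ hC)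
  have h (k : ℕ) : (empiricalMeasure f x (n k) : Measure X) C = 1 := by
    rw [empiricalMeasure_apply _ _ _ hC.measurableSet]
    have h0 : ((n k : ℕ) : ℝ≥0∞) ≠ 0 := by exact_mod_cast (n k).ne_zero
    simp [hx, ENNReal.inv_mul_cancel h0 (ENNReal.natCast_ne_top _)]
  simp [h]

end EmpiricalMeasures

/-! ### The shift space, densities and Bernoulli words. -/

section Shift

lemma continuous_shift : Continuous shift := by
  unfold shift; fun_prop

lemma shift_iterate_apply (y : Omega2) (i : ℕ) (m : ℤ) : shift^[i] y m = y (m + i) := by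
  induction i generalizing y with
  | zero => simp
  | succ i ih => rw [Function.iterate_succ_apply, ih]; simp [shift]; ring_nf

lemma charSeq_natCast (J : Set ℕ) (i : ℕ) : charSeq J i = 1 ↔ i ∈ J := by
  simp [charSeq]

lemma isClopen_coord (m : ℤ) (a : Fin 2) : IsClopen {y : Omega2 | y m = a} :=
  (isClopen_discrete {a}).preimage (continuous_apply m)

/-- The cylinder is clopen, so its empirical masses, which are the frequencies of `J`, converge to
its `ν`-mass. -/
lemma lowerDensity_le_of_tendsto {J : Set ℕ} {n : ℕ → ℕ+} (hn : StrictMono n)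
    {ν : ProbabilityMeasure Omega2}
    (hν : Tendsto (fun k => empiricalMeasure shift (charSeq J) (n k)) atTop (𝓝 ν)) :
    lowerDensity J ≤ (ν : Measure Omega2).real {y | y 0 = 1} := by
  have hn' : StrictMono fun k => (n k : ℕ) := fun a b hab => hn hab
  have hlim : Tendsto
      (fun k => (empiricalMeasure shift (charSeq J) (n k) : Measure Omega2).real {y | y 0 = 1})
      atTop (𝓝 ((ν : Measure Omega2).real {y | y 0 = 1})) :=
    (ENNReal.tendsto_toReal (measure_ne_top _ _)).comp
      (ProbabilityMeasure.tendsto_measure_of_null_frontier_of_tendsto' hν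
        (by simp [(isClopen_coord 0 1).frontier_eq]))
  have hfreq (k : ℕ) : (empiricalMeasure shift (charSeq J) (n k) : Measure Omega2).real
      {y | y 0 = 1} = ((J ∩ Set.Iio (n k : ℕ)).ncard : ℝ) / (n k : ℕ) := by
    classical
    have h : J ∩ Set.Iio (n k : ℕ) = ((Finset.range (n k : ℕ)).filter (· ∈ J) : Finset ℕ) := by
      ext i; simp [and_comm]
    rw [h, Set.ncard_coe_finset, Measure.real, empiricalMeasure_apply _ _ _
      (isClopen_coord 0 1).isClosed.measurableSet]
    simp [Set.indicator_apply, shift_iterate_apply, charSeq_natCast, div_eq_inv_mul]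
  simp only [hfreq] at hlim
  refine le_of_forall_lt fun c hc => ?_
  obtain ⟨b, hcb, hb⟩ := exists_between hc
  -- A real `liminf` is meaningful only with a lower bound on the sequence, here 0.
  have hev : ∀ᶠ N : ℕ in atTop, b < ((J ∩ Set.Iio N).ncard : ℝ) / N :=
    eventually_lt_of_lt_liminf hb
      (isBoundedUnder_of_eventually_ge (a := 0) (Eventually.of_forall fun N => by positivity))
  exact hcb.trans_le (ge_of_tendsto hlim
    ((hn'.tendsto_atTop.eventually hev).mono fun k hk => hk.le))

lemma bernoulliHalf_word (n : ℕ) (w : Fin n → Fin 2) :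
    (bernoulliHalf : Measure Omega2).real
      (partitionName shift (fun y => y 0) n ⁻¹' {w}) = (2 ^ n : ℝ)⁻¹ := by
  let e : Fin n ↪ ℤ := ⟨fun i => ((i : ℕ) : ℤ), fun i j h => by simpa [Fin.ext_iff] using h⟩
  have h : partitionName shift (fun y : Omega2 => y 0) n ⁻¹' {w} =
      Set.pi (Finset.univ.map e : Finset ℤ) (fun m => {b | ∀ i, e i = m → b = w i}) := by
    ext y
    simp only [Set.mem_preimage, Set.mem_singleton_iff, funext_iff, partitionName,
      shift_iterate_apply]
    simp [Set.mem_pi]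
    rfl
  rw [h, bernoulliHalf, Measure.real, ProbabilityMeasure.coe_mk,
    Measure.infinitePi_pi _ fun _ _ => MeasurableSet.of_discrete,
    Finset.prod_map, Finset.prod_congr rfl (g := fun _ => (2 : ℝ≥0∞)⁻¹)]
  · simp
  · intro i _
    have : {b : Fin 2 | ∀ j, e j = e i → b = w j} = {w i} := by
      ext b; simp
    rw [this, PMF.toMeasure_apply_singleton _ _ MeasurableSet.of_discrete]
    simp

end Shift

/-! ### A finite entropy inequality. -/

section ShannonEntropy

/-- If the third coordinate of a random triple takes at most `N b` values once the first two are
known, and it is uniformly distributed, its entropy is bounded by those of the other two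
coordinates and the mean of `log N`. -/
lemma log_card_le_entropy_add {α β γ : Type*} [Fintype α] [Fintype β] [Fintype γ]
    (p : α → β → γ → ℝ) (hp : ∀ a b c, 0 ≤ p a b c) (pa : α → ℝ) (pb : β → ℝ)
    (hpa : ∀ a, pa a = ∑ b, ∑ c, p a b c) (hpb : ∀ b, pb b = ∑ a, ∑ c, p a b c)
    (M : ℝ) (hM : 0 < M) (hpc : ∀ c, ∑ a, ∑ b, p a b c = M⁻¹) (hsum : ∑ a, pa a = 1)
    (N : β → ℝ) (hN : ∀ b, 0 < N b) (S : α → β → Finset γ)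
    (hS : ∀ a b, ((S a b).card : ℝ) ≤ N b) (hpS : ∀ a b c, c ∉ S a b → p a b c = 0) :
    Real.log M ≤ ∑ a, Real.negMulLog (pa a) + ∑ b, Real.negMulLog (pb b) +
      ∑ b, pb b * Real.log (N b) := by
  classical
  have hpa0 a : 0 ≤ pa a := hpa a ▸ Finset.sum_nonneg fun b _ => Finset.sum_nonneg fun c _ => hp ..
  have hpb0 b : 0 ≤ pb b := hpb b ▸ Finset.sum_nonneg fun a _ => Finset.sum_nonneg fun c _ => hp ..
  have hle_a a b c : p a b c ≤ pa a := by
    rw [hpa]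
    exact (Finset.single_le_sum (f := fun c => p a b c) (fun c _ => hp ..)
      (Finset.mem_univ c)).trans (Finset.single_le_sum (f := fun b => ∑ c, p a b c)
        (fun b _ => Finset.sum_nonneg fun c _ => hp ..) (Finset.mem_univ b))
  have hle_b a b c : p a b c ≤ pb b := by
    rw [hpb]
    exact (Finset.single_le_sum (f := fun c => p a b c) (fun c _ => hp ..)
      (Finset.mem_univ c)).trans (Finset.single_le_sum (f := fun a => ∑ c, p a b c)
        (fun b _ => Finset.sum_nonneg fun c _ => hp ..) (Finset.mem_univ a))
  have hle_c a b c : p a b c ≤ M⁻¹ := by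
    rw [← hpc c]
    exact (Finset.single_le_sum (f := fun b => p a b c) (fun c _ => hp ..)
      (Finset.mem_univ b)).trans (Finset.single_le_sum (f := fun a => ∑ b, p a b c)
        (fun b _ => Finset.sum_nonneg fun c _ => hp ..) (Finset.mem_univ a))
  have hsumb : ∑ b, pb b = 1 := by
    rw [← hsum]; simp only [hpa, hpb]; exact Finset.sum_comm
  -- Gibbs' inequality term by term: `log t ≤ t - 1` at `t = M * pa a * pb b / N b`, then `p a b c *
  -- M ≤ 1`. This replaces the chain rule for conditional entropy.
  have key a b c : p a b c * (Real.log M + Real.log (pa a) + Real.log (pb b) - Real.log (N b)) ≤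
      (if c ∈ S a b then pa a * pb b / N b else 0) - p a b c := by
    rcases (hp a b c).eq_or_lt with h | h
    · rw [← h]
      have := hpa0 a; have := hpb0 b; have := hN b
      simp only [zero_mul, sub_zero]
      split_ifs <;> positivity
    have hc : c ∈ S a b := by
      by_contra hc; exact h.ne' (hpS _ _ _ hc)
    have ha := h.trans_le (hle_a a b c)
    have hb := h.trans_le (hle_b a b c)
    have hN' := hN b
    rw [if_pos hc, ← Real.log_mul hM.ne' ha.ne', ← Real.log_mul (by positivity) hb.ne',
      ← Real.log_div (by positivity) hN'.ne']
    calc p a b c * Real.log (M * pa a * pb b / N b)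
        ≤ p a b c * (M * pa a * pb b / N b - 1) := by
          gcongr; exact Real.log_le_sub_one_of_pos (by positivity)
      _ = (p a b c * M) * (pa a * pb b / N b) - p a b c := by ring
      _ ≤ 1 * (pa a * pb b / N b) - p a b c := by
          gcongr
          calc p a b c * M ≤ M⁻¹ * M := by gcongr; exact hle_c a b c
            _ = 1 := inv_mul_cancel₀ hM.ne'
      _ = _ := by ring
  -- As `S a b` has at most `N b` elements, the comparison weights have total mass at most 1, the
  -- mass of `p`.
  have htot : ∑ a, ∑ b, ∑ c, p a b c *
      (Real.log M + Real.log (pa a) + Real.log (pb b) - Real.log (N b)) ≤ 0 := by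
    calc _ ≤ ∑ a, ∑ b, ∑ c, ((if c ∈ S a b then pa a * pb b / N b else 0) - p a b c) := by
          gcongr with a _ b _ c _; exact key a b c
      _ = ∑ a, ∑ b, ((S a b).card * (pa a * pb b / N b)) - ∑ a, pa a := by
          simp only [Finset.sum_sub_distrib, hpa]
          congr 1
          simp
      _ ≤ ∑ a, ∑ b, pa a * pb b - ∑ a, pa a := by
          refine sub_le_sub_right (Finset.sum_le_sum fun a _ => Finset.sum_le_sum fun b _ => ?_) _
          have := hpa0 a; have := hpb0 b; have := hN b
          calc ((S a b).card : ℝ) * (pa a * pb b / N b) ≤ N b * (pa a * pb b / N b) := by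
                gcongr; exact hS a b
            _ = pa a * pb b := by field_simp
      _ = 0 := by simp [← Finset.mul_sum, hsumb]
  have hexp : ∑ a, ∑ b, ∑ c, p a b c *
      (Real.log M + Real.log (pa a) + Real.log (pb b) - Real.log (N b)) =
      Real.log M + ∑ a, pa a * Real.log (pa a) + ∑ b, pb b * Real.log (pb b) -
        ∑ b, pb b * Real.log (N b) := by
    simp only [mul_sub, mul_add, Finset.sum_sub_distrib, Finset.sum_add_distrib, ← Finset.sum_mul]
    simp only [← hpa, hsum, one_mul]
    congr 1
    · congr 1
      rw [Finset.sum_comm]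
      simp only [← Finset.sum_mul, ← hpb]
    · rw [Finset.sum_comm]
      simp only [← Finset.sum_mul, ← hpb]
  simp only [Real.negMulLog, neg_mul, Finset.sum_neg_distrib]
  linarith

end ShannonEntropy

/-! ### Couplings and the entropy of names. -/

section Joinings

lemma measurable_partitionName {X : Type*} [MeasurableSpace X] {f : X → X} (hf : Measurable f)
    {k : ℕ} {ξ : X → Fin k} (hξ : Measurable ξ) (n : ℕ) : Measurable (partitionName f ξ n) :=
  measurable_pi_lambda _ fun i => hξ.comp (hf.iterate i)

lemma sum_measureReal_preimage_singleton_inter {E γ : Type*} [MeasurableSpace E] [Fintype γ]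
    [MeasurableSpace γ] [MeasurableSingletonClass γ] (μ : Measure E) [IsFiniteMeasure μ]
    {T : E → γ} (hT : Measurable T) (s : Set E) :
    ∑ c, μ.real (T ⁻¹' {c} ∩ s) = μ.real s := by
  have h := sum_measureReal_preimage_singleton (μ := μ.restrict s) Finset.univ
    (f := T) fun c _ => hT (measurableSet_singleton c)
  simpa [measureReal_restrict_apply, hT (measurableSet_singleton _)] using h

/-- The mean number of zeros in the initial word of length `n`, for a shift-invariant measure. -/
lemma sum_word_mul_log_prod {ν : ProbabilityMeasure Omega2}
    (hν : MeasurePreserving shift (ν : Measure Omega2) (ν : Measure Omega2)) (n : ℕ) :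
    ∑ b : Fin n → Fin 2,
      (ν : Measure Omega2).real (partitionName shift (fun y => y 0) n ⁻¹' {b}) *
        Real.log (∏ i, if b i = 1 then 1 else 2) =
      n * (1 - (ν : Measure Omega2).real {y | y 0 = 1}) * Real.log 2 := by
  have hT : Measurable (partitionName shift (fun y : Omega2 => y 0) n) :=
    measurable_partitionName continuous_shift.measurable (measurable_pi_apply 0) n
  have hlog (b : Fin n → Fin 2) : Real.log (∏ i, if b i = 1 then 1 else 2) =
      ∑ i, if b i = 1 then 0 else Real.log 2 := by
    rw [Real.log_prod fun i _ => by split_ifs <;> norm_num]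
    exact Finset.sum_congr rfl fun i _ => by split_ifs <;> simp
  -- By invariance the probability of a zero is the same at every coordinate.
  have hcoord (i : Fin n) : ∑ b : Fin n → Fin 2,
      (ν : Measure Omega2).real (partitionName shift (fun y => y 0) n ⁻¹' {b}) *
        (if b i = 1 then 0 else Real.log 2) =
      (1 - (ν : Measure Omega2).real {y | y 0 = 1}) * Real.log 2 := by
    have h0 := sum_measureReal_preimage_singleton (μ := (ν : Measure Omega2))
      (Finset.univ.filter fun b : Fin n → Fin 2 => ¬ b i = 1)
      (f := partitionName shift (fun y => y 0) n) fun c _ => hT (measurableSet_singleton c)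
    have h1 : partitionName shift (fun y : Omega2 => y 0) n ⁻¹'
        (Finset.univ.filter fun b : Fin n → Fin 2 => ¬ b i = 1 : Finset _) =
        (shift^[i] ⁻¹' {y | y 0 = 1})ᶜ := by
      ext y; simp [partitionName]
    have hm : MeasurableSet {y : Omega2 | y 0 = 1} := (isClopen_coord 0 1).isClosed.measurableSet
    rw [h1, probReal_compl_eq_one_sub (continuous_shift.measurable.iterate _ hm),
      (hν.iterate i).measureReal_preimage hm.nullMeasurableSet] at h0
    rw [← h0, Finset.sum_filter, Finset.sum_mul]
    exact Finset.sum_congr rfl fun b _ => by split_ifs <;> simp_all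
  simp only [hlog, Finset.mul_sum]
  rw [Finset.sum_comm, Finset.sum_congr rfl fun i _ => hcoord i]
  simp [mul_assoc]

/-- If, in a joining of `μ`, `ν` and the Bernoulli measure, the `ξ`-names determine the symbols of
the third coordinate at the times selected by the second one, the entropy of the `ξ`-names is at
least the mean number of the selected symbols times `log 2`, up to the entropy of the selection. -/
lemma log_two_le_joinEntropy_add {X : Type*} [MeasurableSpace X] {f : X → X} (hf : Measurable f)
    {ξ : X → Fin 2} (hξ : Measurable ξ) (Λ : Measure (X × Omega2 × Omega2)) [IsProbabilityMeasure Λ]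
    {μ : ProbabilityMeasure X} {ν : ProbabilityMeasure Omega2}
    (hμ : Λ.map (fun e => e.1) = μ) (hν : Λ.map (fun e => e.2.1) = ν)
    (hβ : Λ.map (fun e => e.2.2) = bernoulliHalf)
    (hνinv : MeasurePreserving shift (ν : Measure Omega2) (ν : Measure Omega2))
    (hdet : ∀ i : ℕ, ∀ᵐ e ∂Λ, e.2.1 i = 1 → e.2.2 i = ξ (f^[i] e.1)) (n : ℕ) :
    n * (ν : Measure Omega2).real {y | y 0 = 1} * Real.log 2 ≤
      joinEntropy μ f ξ n + joinEntropy ν shift (fun y => y 0) n := by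
  let A : X × Omega2 × Omega2 → Fin n → Fin 2 := fun e => partitionName f ξ n e.1
  let B : X × Omega2 × Omega2 → Fin n → Fin 2 :=
    fun e => partitionName shift (fun y => y 0) n e.2.1
  let C : X × Omega2 × Omega2 → Fin n → Fin 2 :=
    fun e => partitionName shift (fun y => y 0) n e.2.2
  have hT : Measurable (partitionName shift (fun y : Omega2 => y 0) n) :=
    measurable_partitionName continuous_shift.measurable (measurable_pi_apply 0) n
  have hU := measurable_partitionName hf hξ n
  have hA : Measurable A := hU.comp measurable_fst
  have hB : Measurable B := hT.comp measurable_snd.fst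
  have hC : Measurable C := hT.comp measurable_snd.snd
  have hμr a : (μ : Measure X).real (partitionName f ξ n ⁻¹' {a}) = Λ.real (A ⁻¹' {a}) := by
    rw [← hμ, map_measureReal_apply measurable_fst (hU (measurableSet_singleton a))]; rfl
  have hνr b : (ν : Measure Omega2).real (partitionName shift (fun y => y 0) n ⁻¹' {b}) =
      Λ.real (B ⁻¹' {b}) := by
    rw [← hν, map_measureReal_apply measurable_snd.fst (hT (measurableSet_singleton b))]; rfl
  have hβr c : Λ.real (C ⁻¹' {c}) = (2 ^ n : ℝ)⁻¹ := by
    rw [← bernoulliHalf_word n c, ← hβ,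
      map_measureReal_apply measurable_snd.snd (hT (measurableSet_singleton c))]; rfl
  have key := log_card_le_entropy_add
    (fun a b c => Λ.real (C ⁻¹' {c} ∩ (B ⁻¹' {b} ∩ A ⁻¹' {a})))
    (fun _ _ _ => measureReal_nonneg) (fun a => Λ.real (A ⁻¹' {a})) (fun b => Λ.real (B ⁻¹' {b}))
    (fun a => by simp only [sum_measureReal_preimage_singleton_inter Λ hC,
      sum_measureReal_preimage_singleton_inter Λ hB])
    (fun b => by
      simp only [sum_measureReal_preimage_singleton_inter Λ hC, Set.inter_comm (B ⁻¹' {b}),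
        sum_measureReal_preimage_singleton_inter Λ hA])
    (2 ^ n) (by positivity)
    (fun c => by
      rw [Finset.sum_comm, ← hβr c]
      have h b a : C ⁻¹' {c} ∩ (B ⁻¹' {b} ∩ A ⁻¹' {a}) = A ⁻¹' {a} ∩ (B ⁻¹' {b} ∩ C ⁻¹' {c}) := by
        ext e; simp only [Set.mem_inter_iff]; tauto
      simp only [h, sum_measureReal_preimage_singleton_inter Λ hA,
        sum_measureReal_preimage_singleton_inter Λ hB])
    (by simpa using sum_measureReal_preimage_singleton_inter Λ hA Set.univ)
    -- Two to the number of zeros of `b`: the count of words with prescribed symbols at the selected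
    -- times, which form the set given next.
    (fun b => ∏ i, if b i = 1 then 1 else 2)
    (fun b => Finset.prod_pos fun i _ => by split_ifs <;> norm_num)
    (fun a b => Fintype.piFinset fun i => if b i = 1 then {a i} else Finset.univ)
    (fun a b => by
      rw [Fintype.card_piFinset]
      push_cast
      refine (Finset.prod_congr rfl fun i _ => ?_).le
      split_ifs <;> simp)
    (fun a b c hc => by
      rw [measureReal_eq_zero_iff]
      have hall : ∀ᵐ e ∂Λ, ∀ i : ℕ, e.2.1 i = 1 → e.2.2 i = ξ (f^[i] e.1) := ae_all_iff.2 hdet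
      refine measure_mono_null ?_ hall
      rintro e ⟨rfl, rfl, rfl⟩ he
      refine hc (Fintype.mem_piFinset.2 fun i => ?_)
      split_ifs with h
      · simpa [A, B, C, partitionName, shift_iterate_apply] using
          he i (by simpa [B, partitionName, shift_iterate_apply] using h)
      · simp)
  simp only [← hμr, ← hνr] at key
  rw [sum_word_mul_log_prod hνinv, Real.log_pow] at key
  simp only [joinEntropy]
  linarith

end Joinings

/-! ### Passing to entropy rates. -/

section EntropyBound

lemma joinEntropy_nonneg {X : Type*} [MeasurableSpace X] (μ : ProbabilityMeasure X) (f : X → X)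
    {k : ℕ} (ξ : X → Fin k) (n : ℕ) : 0 ≤ joinEntropy μ f ξ n :=
  Finset.sum_nonneg fun _ _ => Real.negMulLog_nonneg measureReal_nonneg measureReal_le_one

/-- Nonnegativity of Shannon entropy turns a zero upper limit into a genuine limit. -/
lemma tendsto_joinEntropy_div_of_entropy_eq_zero {X : Type*} [MeasurableSpace X]
    {μ : ProbabilityMeasure X} {f : X → X} (h : entropy μ f = 0) {k : ℕ} {ξ : X → Fin k}
    (hξ : Measurable ξ) : Tendsto (fun n : ℕ => joinEntropy μ f ξ n / n) atTop (𝓝 0) := by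
  have h0 : partitionEntropy μ f ξ = 0 := by
    refine le_antisymm ?_ zero_le
    rw [← h]
    exact le_iSup_of_le k (le_iSup_of_le ξ (le_iSup_of_le hξ le_rfl))
  have h1 : Tendsto (fun n : ℕ => ENNReal.ofReal (joinEntropy μ f ξ n / n)) atTop (𝓝 0) :=
    tendsto_of_le_liminf_of_limsup_le zero_le h0.le
  have h2 := (ENNReal.tendsto_toReal ENNReal.zero_ne_top).comp h1
  refine h2.congr fun n => ?_
  exact ENNReal.toReal_ofReal (div_nonneg (joinEntropy_nonneg ..) n.cast_nonneg)

end EntropyBound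

theorem lowerDensity_mul_log_two_le_entropy {X : Type*} [MetricSpace X] [CompactSpace X]
    [MeasurableSpace X] [BorelSpace X] {f : X → X} (hf : Continuous f)
    {K : Fin 2 → Set X} (hK : ∀ i, IsCompact (K i)) (hdisj : Disjoint (K 0) (K 1))
    {J : Set ℕ} (hJ : CompletelyDeterministic J) {x : X} {ω : Omega2} (hω : IsItinerary f K x J ω)
    (hgen : IsGeneric shift ω bernoulliHalf) {μ : ProbabilityMeasure X}
    (hμ : μ ∈ generatedMeasures f x) :
    ENNReal.ofReal (lowerDensity J * Real.log 2) ≤ entropy μ f := by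
  classical
  obtain ⟨-, n, hn, hlim⟩ := hμ
  let F : X × Omega2 × Omega2 → X × Omega2 × Omega2 := Prod.map f (Prod.map shift shift)
  obtain ⟨Λ, φ, hφ, hΛ⟩ := CompactSpace.tendsto_subseq
    (fun k => empiricalMeasure F (x, charSeq J, ω) (n k))
  have hnφ : StrictMono (n ∘ φ) := hn.comp hφ
  have hm1 : Continuous fun e : X × Omega2 × Omega2 => e.1 := continuous_fst
  have hm2 : Continuous fun e : X × Omega2 × Omega2 => e.2.1 := continuous_snd.fst
  have hm3 : Continuous fun e : X × Omega2 × Omega2 => e.2.2 := continuous_snd.snd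
  have hΛ1 := ProbabilityMeasure.tendsto_map_of_tendsto_of_continuous _ _ hΛ hm1
  have hΛ2 := ProbabilityMeasure.tendsto_map_of_tendsto_of_continuous _ _ hΛ hm2
  have hΛ3 := ProbabilityMeasure.tendsto_map_of_tendsto_of_continuous _ _ hΛ hm3
  have hF1 : Function.Semiconj (fun e : X × Omega2 × Omega2 => e.1) F f := fun _ => rfl
  have hF2 : Function.Semiconj (fun e : X × Omega2 × Omega2 => e.2.1) F shift := fun _ => rfl
  have hF3 : Function.Semiconj (fun e : X × Omega2 × Omega2 => e.2.2) F shift := fun _ => rfl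
  simp only [Function.comp_apply, map_empiricalMeasure hF1 hm1.measurable] at hΛ1
  simp only [Function.comp_apply, map_empiricalMeasure hF2 hm2.measurable] at hΛ2
  simp only [Function.comp_apply, map_empiricalMeasure hF3 hm3.measurable] at hΛ3
  have hμ := tendsto_nhds_unique hΛ1 (hlim.comp hφ.tendsto_atTop)
  set ν := Λ.map hm2.measurable.aemeasurable with hνdef
  have hνinv := measurePreserving_of_tendsto_empiricalMeasure continuous_shift hnφ hΛ2
  have hν0 : entropy ν shift = 0 := hJ ν ⟨hνinv, _, hnφ, hΛ2⟩
  have hβ : Λ.map hm3.measurable.aemeasurable = bernoulliHalf := by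
    have : Λ.map hm3.measurable.aemeasurable ∈ generatedMeasures shift ω :=
      ⟨measurePreserving_of_tendsto_empiricalMeasure continuous_shift hnφ hΛ3, _, hnφ, hΛ3⟩
    rwa [show generatedMeasures shift ω = {bernoulliHalf} from hgen] at this
  have hdens : lowerDensity J ≤ (ν : Measure Omega2).real {y | y 0 = 1} :=
    lowerDensity_le_of_tendsto hnφ hΛ2
  -- Points outside both sets also get label 0; only the labels on `K 0` and `K 1` matter.
  let ξ : X → Fin 2 := (K 1).piecewise (fun _ => 1) (fun _ => 0)
  have hξ : Measurable ξ :=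
    Measurable.piecewise (hK 1).isClosed.measurableSet measurable_const measurable_const
  have hξK (a : Fin 2) (y : X) (hy : y ∈ K a) : ξ y = a := by
    fin_cases a
    · exact Set.piecewise_eq_of_notMem _ _ _ (Set.disjoint_left.1 hdisj hy)
    · exact Set.piecewise_eq_of_mem _ _ _ hy
  have hdet (i : ℕ) : ∀ᵐ e ∂(Λ : Measure (X × Omega2 × Omega2)),
      e.2.1 i = 1 → e.2.2 i = ξ (f^[i] e.1) := by
    -- Stated with `K` rather than `ξ`, the relation is closed, because its symbol conditions are
    -- clopen.
    let D : Set (X × Omega2 × Omega2) := {e | e.2.1 i = 1 → f^[i] e.1 ∈ K (e.2.2 i)}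
    have hD : IsClosed D := by
      have : D = {e | e.2.1 i = 1}ᶜ ∪ ⋃ a : Fin 2, {e | e.2.2 i = a} ∩ {e | f^[i] e.1 ∈ K a} := by
        ext e; simp [D, imp_iff_not_or]
      rw [this]
      refine IsClosed.union ?_ (isClosed_iUnion_of_finite fun a => IsClosed.inter ?_ ?_)
      · exact ((isClopen_coord i 1).preimage hm2).compl.isClosed
      · exact ((isClopen_coord i a).preimage hm3).isClosed
      · exact (hK a).isClosed.preimage ((hf.iterate i).comp hm1)
    have hone := measure_eq_one_of_tendsto_empiricalMeasure hΛ hD fun j => by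
      have h1 := (hF1.iterate_right j).eq (x, charSeq J, ω)
      have h2 := (hF2.iterate_right j).eq (x, charSeq J, ω)
      have h3 := (hF3.iterate_right j).eq (x, charSeq J, ω)
      simp only at h1 h2 h3
      simp only [D, Set.mem_ofPred_eq, h1, h2, h3, shift_iterate_apply,
        ← Function.iterate_add_apply]
      intro h
      -- Coordinate `i` at time `j` of the orbit reads the itinerary at time `i + j`.
      exact_mod_cast hω (i + j) ((charSeq_natCast J _).1 (by exact_mod_cast h))
    filter_upwards [mem_ae_iff.2 ((prob_compl_eq_zero_iff hD.measurableSet).2 hone)] with e he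
    exact fun h => (hξK _ _ (he h)).symm
  have key := log_two_le_joinEntropy_add hf.measurable hξ (Λ : Measure (X × Omega2 × Omega2))
    (congrArg Subtype.val hμ) rfl (congrArg Subtype.val hβ) hνinv hdet
  have hsmall := tendsto_joinEntropy_div_of_entropy_eq_zero hν0
    (measurable_pi_apply (0 : ℤ) : Measurable fun y : Omega2 => y 0)
  have hlow : Tendsto (fun m : ℕ => ENNReal.ofReal
      (lowerDensity J * Real.log 2 - joinEntropy ν shift (fun y => y 0) m / m)) atTop
      (𝓝 (ENNReal.ofReal (lowerDensity J * Real.log 2))) := by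
    simpa using ENNReal.tendsto_ofReal (hsmall.const_sub (lowerDensity J * Real.log 2))
  refine le_trans ?_ (le_iSup_of_le 2 (le_iSup_of_le ξ (le_iSup_of_le hξ le_rfl)))
  rw [← hlow.limsup_eq]
  refine limsup_le_limsup ?_
  filter_upwards [eventually_gt_atTop 0] with m hm
  have hm' : (0 : ℝ) < m := by exact_mod_cast hm
  refine ENNReal.ofReal_le_ofReal ?_
  rw [sub_le_iff_le_add, ← add_div, le_div_iff₀ hm']
  refine le_trans ?_ (key m)
  calc lowerDensity J * Real.log 2 * m = m * lowerDensity J * Real.log 2 := by ring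
    _ ≤ _ := by have := Real.log_nonneg one_le_two; gcongr

end EntropyControl

theorem theorem3 {X : Type*} [MetricSpace X] [CompactSpace X] [MeasurableSpace X] [BorelSpace X]
    (f : X → X) (hf : Continuous f)
    (K : Fin 2 → Set X) (hK : ∀ i, IsCompact (K i)) (hdisj : Disjoint (K 0) (K 1))
    (J : Set ℕ) (hJ : EntropyControl.CompletelyDeterministic J)
    (hdens : 0 < EntropyControl.lowerDensity J)
    (x : X) (ω : EntropyControl.Omega2) (hω : EntropyControl.IsItinerary f K x J ω)
    (hgen : EntropyControl.IsGeneric EntropyControl.shift ω EntropyControl.bernoulliHalf) :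
    0 < EntropyControl.lowerDensity J * Real.log 2 ∧
      ∀ μ ∈ EntropyControl.generatedMeasures f x,
        ENNReal.ofReal (EntropyControl.lowerDensity J * Real.log 2) ≤
          EntropyControl.entropy μ f := by
  exact ⟨mul_pos hdens (Real.log_pos one_lt_two), fun _ hμ =>
    EntropyControl.lowerDensity_mul_log_two_le_entropy hf hK hdisj hJ hω hgen hμ⟩
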